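/- **Terminology.** A category $\mathbf C$ is *$\mathbf{Cppo}$-enriched* if every hom-set carries a partial order with a least element $\bot$ and joins of all $\omega$-chains, and composition preserves joins of $\omega$-chains in each argument; composition is *left strict* if $\bot\circ f=\bot$ for all $f$. An endofunctor of $\mathbf C$ is *locally continuous* if its action on each hom-set preserves joins of $\omega$-chains. If $F\colon\mathbf C\to\mathbf C$ has a free algebra $(F^*X,\ \tau_X\colon FF^*X\to F^*X,\ \eta_X\colon X\to F^*X)$ on every object $X$, its *free monad* is $F^*$ with unit $\eta$ and with multiplication $\mu_X$ the unique $F$-algebra homomorphism $F^*F^*X\to F^*X$ such that $\mu_X\circ\eta_{F^*X}=\mathrm{id}$. A *monad quotient* is a monad morphism with epimorphic components. For a monad $M$ on $\mathbf{Sets}$, let $\mathcal J\colon\mathbf{Sets}\to\mathcal{K}\ell(M)$ be the canonical functor into the Kleisli category (the identity on objects). A *lifting* of an endofunctor $H$ of $\mathbf{Sets}$ is an endofunctor $\overline H$ of $\mathcal K\ell(M)$ with $\overline H\mathcal J=\mathcal JH$; a *lifting* of a monad $(T,\eta,\mu)$ is a monad on $\mathcal K\ell(M)$ whose functor part is a lifting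 $\overline T$ of $T$ and whose unit and multiplication have components $\mathcal J\eta_X$ and $\mathcal J\mu_X$. A lifting $\overline H$ corresponds to the distributive law $\lambda^H\colon HM\Rightarrow MH$ whose component $\lambda^H_X$ is $\overline H$ applied to $\mathrm{id}_{MX}$, seen as a Kleisli morphism $MX\to X$. **Theorem.** Let $M$ be a monad on $\mathbf{Sets}$ and $H\colon\mathbf{Sets}\to\mathbf{Sets}$ a functor such that * (a) $\mathcal K\ell(M)$ is $\mathbf{Cppo}$-enriched with left strict composition; * (b) $H$ is accessible (it preserves $\kappa$-filtered colimits for some regular cardinal $\kappa$) and has a locally continuous lifting $\overline H\colon\mathcal K\ell(M)\to\mathcal K\ell(M)$. Then $H$ has a free algebra on every set. For every choice of free algebras, with free monad $H^*$, let $\lambda_X\colon H^*MX\to MH^*X$ be the unique $H$-algebra homomorphism from $(H^*MX,\tau_{MX})$ to $(MH^*X,\ M\tau_X\circ\lambda^H_{H^*X})$ with $\lambda_X\circ\eta_{MX}=M\eta_X$. Then $\lambda$ is a distributive law of the monad $H^*$ over the monad $M$, and the lifting $\overline{H^*}$ of the monad $H^*$ given by $\lambda$ (sending $f\colon X\to MY$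 to $\lambda_Y\circ H^*f$) equals the free monad $\overline H^{\,*}$ on $\overline H$ formed with the free $\overline H$-algebras $(H^*X,\mathcal J\tau_X,\mathcal J\eta_X)$. Let moreover $R$ be a monad on $\mathbf{Sets}$ and $q\colon H^*\Rightarrow R$ a monad quotient such that * (c) for each set $X$ there is a map $\lambda'_X\colon RMX\to MRX$ with $\lambda'_X\circ q_{MX}=Mq_X\circ\lambda_X$. Then: 1. There are a monad $\overline R$ on $\mathcal K\ell(M)$ lifting the monad $R$ and a monad morphism $\overline q\colon\overline H^{\,*}\Rightarrow\overline R$ with components $\overline q_X=\mathcal J(q_X)$. 2. For every set $X$, the data $\mathcal K\ell(M)$, $\overline H$, $\overline H^{\,*}$, $\overline H\mathcal JX+\mathrm{Id}$, $\overline R$ and $\overline q$ satisfy the standing assumption of quotient semantics, namely: * $\mathcal K\ell(M)$ is $\mathbf{Cppo}$-enriched, has coproducts, and its composition is left strict; * $\overline H$ is locally continuous and all free $\overline H$-algebras exist; * for every object $Y$ there is an initial algebra for the functor $\overline H^{\,*}(\mathrm{Id}+Y)$; * for every object $Y$ there is an initial algebra for the functor $\overline H\mathcal JX+(\mathrm{Id}+Y)$,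 where $\overline H\mathcal JX+\mathrm{Id}$ is the exception monad; * $\overline q$ is a monad quotient, i.e. every component of $\overline q$ is an epimorphism in $\mathcal K\ell(M)$; * for every object $Y$ there is an initial algebra for the functor $\overline R(\mathrm{Id}+Y)$. -/

import Mathlib

open CategoryTheory CategoryTheory.Limits CategoryTheory.Endofunctor OmegaCompletePartialOrder

universe v u

namespace KleisliTrace

/-! ### Categories enriched over cpos with bottom -/

/-- A category enriched over cpos with bottom: every hom-set is an `ω`-complete partial order with
a least element, and composition preserves joins of `ω`-chains in each argument. -/
class CppoEnriched (C : Type u) [Category.{v} C] where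
  homCpo : ∀ X Y : C, OmegaCompletePartialOrder (X ⟶ Y)
  homBot : ∀ X Y : C, OrderBot (X ⟶ Y)
  continuous_precomp : ∀ {X Y : C} (f : X ⟶ Y) (Z : C),
    ωScottContinuous (fun g : Y ⟶ Z => f ≫ g)
  continuous_postcomp : ∀ (X : C) {Y Z : C} (g : Y ⟶ Z),
    ωScottContinuous (fun f : X ⟶ Y => f ≫ g)

attribute [reducible, instance] CppoEnriched.homCpo CppoEnriched.homBot

/-- Composition is left strict: `⊥ ∘ f = ⊥`. -/
def LeftStrict (C : Type u) [Category.{v} C] [CppoEnriched C] : Prop :=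
  ∀ {X Y : C} (f : X ⟶ Y) (Z : C), f ≫ (⊥ : Y ⟶ Z) = ⊥

/-- An endofunctor is locally continuous if its action on each hom-set preserves joins of
`ω`-chains. -/
def LocallyContinuous {C : Type u} [Category.{v} C] [CppoEnriched C] (F : C ⥤ C) : Prop :=
  ∀ X Y : C, ωScottContinuous (fun f : X ⟶ Y => F.map f)

/-! ### Free algebras and free monads -/

section FreeMonad

variable {C : Type u} [Category.{v} C]

/-- A free `F`-algebra on the object `X`. -/
structure FreeAlgebra (F : C ⥤ C) (X : C) where
  /-- the algebra, with carrier `alg.a` and structure `alg.str` -/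
  alg : Algebra F
  /-- the universal morphism -/
  unit : X ⟶ alg.a
  /-- the unique extension of `f` to an algebra homomorphism -/
  desc (B : Algebra F) (f : X ⟶ B.a) : alg ⟶ B
  unit_desc (B : Algebra F) (f : X ⟶ B.a) : unit ≫ (desc B f).f = f
  hom_ext {B : Algebra F} (g h : alg ⟶ B) (w : unit ≫ g.f = unit ≫ h.f) : g = h

attribute [simp] FreeAlgebra.unit_desc

@[simp]
theorem FreeAlgebra.unit_desc_assoc {F : C ⥤ C} {X : C} (A : FreeAlgebra F X) (B : Algebra F)
    (f : X ⟶ B.a) {Z : C} (g : B.a ⟶ Z) : A.unit ≫ (A.desc B f).f ≫ g = f ≫ g := by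
  rw [← Category.assoc, A.unit_desc]

/-- The free monad on `F` given by free `F`-algebras on all objects: its unit is the universal
morphism, and its multiplication at `X` is the unique algebra homomorphism from the free algebra
on the carrier of the free algebra on `X` that extends the identity. -/
@[simps! obj map η μ]
abbrev freeMonad {F : C ⥤ C} (A : ∀ X : C, FreeAlgebra F X) : Monad C where
  obj X := (A X).alg.a
  map {X Y} f := ((A X).desc (A Y).alg (f ≫ (A Y).unit)).f
  map_id X := by
    have h : (A X).desc (A X).alg (𝟙 X ≫ (A X).unit) = 𝟙 _ := by
      apply FreeAlgebra.hom_ext; simp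
    rw [h]; rfl
  map_comp {X Y Z} f g := by
    have h : (A X).desc (A Z).alg ((f ≫ g) ≫ (A Z).unit) =
        (A X).desc (A Y).alg (f ≫ (A Y).unit) ≫ (A Y).desc (A Z).alg (g ≫ (A Z).unit) := by
      apply FreeAlgebra.hom_ext; simp
    rw [h]; rfl
  η := { app := fun X => (A X).unit }
  μ :=
    { app := fun X => ((A (A X).alg.a).desc (A X).alg (𝟙 _)).f
      naturality := fun X Y f => by
        dsimp
        rw [← Algebra.comp_f, ← Algebra.comp_f]
        refine congrArg Algebra.Hom.f ((A (A X).alg.a).hom_ext _ _ ?_)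
        simp }
  assoc X := by
    dsimp
    rw [← Algebra.comp_f, ← Algebra.comp_f]
    congr 1
    apply FreeAlgebra.hom_ext
    simp
  left_unit X := by simp
  right_unit X := by
    dsimp
    rw [← Algebra.comp_f, ← Algebra.id_f]
    congr 1
    apply FreeAlgebra.hom_ext
    simp

/-- A quotient of monads is a monad morphism with epimorphic components. -/
def IsMonadQuotient {T S : Monad C} (q : T ⟶ S) : Prop :=
  ∀ X : C, Epi (q.app X)

end FreeMonad

/-! ### The assumptions on systems and on quotients -/

section Assumptions

variable {C : Type u} [Category.{v} C]

/-- For every object `Y` there is an initial algebra for the functor `T(Id + Y)`. -/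
def HasParametrizedInitialAlgebras [HasBinaryCoproducts C] (T : C ⥤ C) : Prop :=
  ∀ Y : C, HasInitial (Algebra (coprod.functor.flip.obj Y ⋙ T))

/-- The standing assumption on `C`, a functor `F` with free algebras `A` (and hence with the free
monad `freeMonad A`) and the exception monad `F X + Id` for the object `X`. -/
structure SystemAssumption [CppoEnriched C] (F : C ⥤ C) (A : ∀ Y : C, FreeAlgebra F Y) (X : C) :
    Prop where
  hasCoproducts : HasCoproducts.{v} C
  leftStrict : LeftStrict C
  locallyContinuous : LocallyContinuous F
  initial_free :
    haveI : HasFiniteCoproducts C := hasFiniteCoproducts_of_hasCoproducts.{v} C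
    HasParametrizedInitialAlgebras (freeMonad A).toFunctor
  initial_exception :
    haveI : HasFiniteCoproducts C := hasFiniteCoproducts_of_hasCoproducts.{v} C
    HasParametrizedInitialAlgebras (coprodMonad (F.obj X)).toFunctor

/-- The standing assumption on a quotient `q` of the free monad on `F`. -/
structure QuotientAssumption [CppoEnriched C] (F : C ⥤ C) (A : ∀ Y : C, FreeAlgebra F Y) (X : C)
    (Q : Monad C) (q : freeMonad A ⟶ Q) : Prop extends SystemAssumption F A X where
  isMonadQuotient : IsMonadQuotient q
  initial_quotient :
    haveI : HasFiniteCoproducts C := hasFiniteCoproducts_of_hasCoproducts.{v} C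
    HasParametrizedInitialAlgebras Q.toFunctor

end Assumptions

/-! ### Liftings to the Kleisli category and distributive laws -/

section Lifting

variable {C : Type u} [Category.{v} C]

/-- The canonical functor `J : C ⥤ Kl(M)`. -/
abbrev J (M : Monad C) : C ⥤ Kleisli M := Kleisli.Adjunction.toKleisli M

theorem J_map_comp_of {M : Monad C} {X Y : C} {Z : Kleisli M} (f : X ⟶ Y)
    (g : Kleisli.mk M Y ⟶ Z) : ((J M).map f ≫ g).of = f ≫ g.of := by
  have h : (f ≫ M.η.app Y) ≫ M.map g.of ≫ M.μ.app Z.of = f ≫ g.of := by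
    simp [← M.unit_naturality_assoc]
  exact h

theorem comp_J_map_of {M : Monad C} {X Y : C} {Z : Kleisli M} (g : Z ⟶ Kleisli.mk M X)
    (f : X ⟶ Y) : (g ≫ (J M).map f).of = g.of ≫ M.map f := by
  have h : g.of ≫ M.map (f ≫ M.η.app Y) ≫ M.μ.app Y = g.of ≫ M.map f := by
    simp
  exact h

/-- A lifting of `H` to the Kleisli category of `M`: an endofunctor of `Kl(M)` whose composite
with `J` is `J ∘ H`. As `J` is the identity on objects, this is an action of `H` on Kleisli
morphisms that preserves Kleisli composition and sends `J f` to `J (H f)`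
(see `exists_functorLifting_iff`). -/
structure FunctorLifting (M : Monad C) (H : C ⥤ C) where
  map {X Y : C} (f : X ⟶ M.obj Y) : H.obj X ⟶ M.obj (H.obj Y)
  map_kleisliComp {X Y Z : C} (f : X ⟶ M.obj Y) (g : Y ⟶ M.obj Z) :
    map (f ≫ M.map g ≫ M.μ.app Z) = map f ≫ M.map (map g) ≫ M.μ.app (H.obj Z)
  map_J {X Y : C} (f : X ⟶ Y) : map (f ≫ M.η.app Y) = H.map f ≫ M.η.app (H.obj Y)

/-- The endofunctor of the Kleisli category given by a lifting. -/
@[simps]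
abbrev FunctorLifting.functor {M : Monad C} {H : C ⥤ C} (L : FunctorLifting M H) :
    Kleisli M ⥤ Kleisli M where
  obj X := .mk M (H.obj X.of)
  map f := .mk (L.map f.of)
  map_id X := by
    apply Kleisli.hom_ext
    simpa using L.map_J (𝟙 X.of)
  map_comp f g := by
    apply Kleisli.hom_ext
    simpa using L.map_kleisliComp f.of g.of

theorem FunctorLifting.functor_map_J {M : Monad C} {H : C ⥤ C} (L : FunctorLifting M H)
    {X Y : C} (f : X ⟶ Y) : L.functor.map ((J M).map f) = (J M).map (H.map f) := by
  apply Kleisli.hom_ext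
  exact L.map_J f

theorem exists_functorLifting_iff {M : Monad C} {H : C ⥤ C} (K : Kleisli M ⥤ Kleisli M) :
    (∃ L : FunctorLifting M H, L.functor = K) ↔ J M ⋙ K = H ⋙ J M := by
  constructor
  · rintro ⟨L, rfl⟩
    exact CategoryTheory.Functor.hext (fun X => rfl) (fun X Y f => heq_of_eq (L.functor_map_J f))
  · intro h
    have hobj : K.obj = fun X => .mk M (H.obj X.of) := by
      funext X
      exact Functor.congr_obj h X.of
    cases K with | mk o m m_id m_comp =>
    dsimp only at hobj
    subst hobj
    have hJ {X Y : C} (f : X ⟶ Y) : m ((J M).map f) = (J M).map (H.map f) :=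
      (Functor.congr_hom h f).trans ((Category.id_comp _).trans (Category.comp_id _))
    refine ⟨⟨fun {X Y} f => (m (X := .mk M X) (Y := .mk M Y) (.mk f)).of, ?_, ?_⟩, rfl⟩
    · intro X Y Z f g
      exact congrArg Kleisli.Hom.of
        (m_comp (X := .mk M X) (Y := .mk M Y) (Z := .mk M Z) (.mk f) (.mk g))
    · intro X Y f
      exact congrArg Kleisli.Hom.of (hJ f)

/-- A lifting of the monad `T` to the Kleisli category of `M`: a lifting of the functor `T` such
that the families `J η` and `J μ` are natural with respect to it. -/
structure MonadLifting (M T : Monad C) extends FunctorLifting M T.toFunctor where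
  unit_naturality {X Y : C} (f : X ⟶ M.obj Y) :
    f ≫ M.map (T.η.app Y) = T.η.app X ≫ map f
  mul_naturality {X Y : C} (f : X ⟶ M.obj Y) :
    map (map f) ≫ M.map (T.μ.app Y) = T.μ.app X ≫ map f

/-- The monad on the Kleisli category given by a lifting of `T`, with unit `J η` and
multiplication `J μ`. -/
abbrev MonadLifting.monad {M T : Monad C} (L : MonadLifting M T) : Monad (Kleisli M) where
  toFunctor := L.functor
  η :=
    { app := fun X => (J M).map (T.η.app X.of)
      naturality := fun X Y f => by
        apply Kleisli.hom_ext
        exact (comp_J_map_of f _).trans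
          ((L.unit_naturality f.of).trans (J_map_comp_of _ (L.functor.map f)).symm) }
  μ :=
    { app := fun X => (J M).map (T.μ.app X.of)
      naturality := fun X Y f => by
        apply Kleisli.hom_ext
        exact (comp_J_map_of (L.functor.map (L.functor.map f)) _).trans
          ((L.mul_naturality f.of).trans (J_map_comp_of _ (L.functor.map f)).symm) }
  assoc X := by
    have h := congrArg (J M).map (T.assoc X.of)
    rw [Functor.map_comp, Functor.map_comp, ← L.functor_map_J] at h
    exact h
  left_unit X := by
    have h := congrArg (J M).map (T.left_unit X.of)
    rw [Functor.map_comp] at h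
    exact h.trans ((J M).map_id _)
  right_unit X := by
    have h := congrArg (J M).map (T.right_unit X.of)
    rw [Functor.map_comp, ← L.functor_map_J] at h
    exact h.trans ((J M).map_id _)

/-- A distributive law of the monad `T` over the monad `M`. -/
structure IsDistributiveLaw (T M : Monad C)
    (law : ∀ X : C, T.obj (M.obj X) ⟶ M.obj (T.obj X)) : Prop where
  naturality {X Y : C} (f : X ⟶ Y) : T.map (M.map f) ≫ law Y = law X ≫ M.map (T.map f)
  unit_right (X : C) : T.map (M.η.app X) ≫ law X = M.η.app (T.obj X)
  mul_right (X : C) :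
    T.map (M.μ.app X) ≫ law X = law (M.obj X) ≫ M.map (law X) ≫ M.μ.app (T.obj X)
  unit_left (X : C) : T.η.app (M.obj X) ≫ law X = M.map (T.η.app X)
  mul_left (X : C) :
    T.μ.app (M.obj X) ≫ law X = T.map (law X) ≫ law (T.obj X) ≫ M.map (T.μ.app X)

variable {M : Monad C} {H : C ⥤ C}

/-- The distributive law `H M ⇒ M H` of the functor `H` over `M` that corresponds to a lifting. -/
def FunctorLifting.law (L : FunctorLifting M H) (X : C) :
    H.obj (M.obj X) ⟶ M.obj (H.obj X) :=
  L.map (𝟙 (M.obj X))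

/-- The action of a lifting on Kleisli morphisms, expressed through its distributive law. -/
theorem FunctorLifting.map_eq_law (L : FunctorLifting M H) {X Y : C} (f : X ⟶ M.obj Y) :
    L.map f = H.map f ≫ L.law Y := by
  have h := L.map_kleisliComp (f ≫ M.η.app _) (𝟙 (M.obj Y))
  rw [L.map_J] at h
  simpa [FunctorLifting.law, ← M.unit_naturality_assoc] using h

/-- A Kleisli morphism `g` is an algebra homomorphism from `(K, J s)` to `(Y, t)` for the lifting
of `H` if and only if it is an `H`-algebra homomorphism from `(K, s)` to `M Y`. -/
theorem FunctorLifting.isAlgebraHom_iff (L : FunctorLifting M H) {K Y : C} (s : H.obj K ⟶ K)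
    (t : L.functor.obj (.mk M Y) ⟶ .mk M Y) (g : K ⟶ M.obj Y) :
    L.functor.map (X := .mk M K) (Y := .mk M Y) (.mk g) ≫ t = (J M).map s ≫ .mk g ↔
      H.map g ≫ L.law Y ≫ M.map t.of ≫ M.μ.app Y = s ≫ g := by
  have h1 : (L.functor.map (X := .mk M K) (Y := .mk M Y) (.mk g) ≫ t).of =
      H.map g ≫ L.law Y ≫ M.map t.of ≫ M.μ.app Y :=
    (congrArg (· ≫ M.map t.of ≫ M.μ.app Y) (L.map_eq_law g)).trans (Category.assoc _ _ _)
  have h2 : ((J M).map s ≫ (.mk g : Kleisli.Hom (.mk M K) (.mk M Y))).of = s ≫ g :=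
    J_map_comp_of s _
  rw [← h1, ← h2]
  exact ⟨fun h => congrArg Kleisli.Hom.of h, fun h => Kleisli.hom_ext h⟩

/-- The distributive law of the free monad on `H` over `M`: its component at `X` is the unique
`H`-algebra homomorphism from the free algebra on `M X` to `M` of the free algebra on `X`
that extends `M η`. -/
def freeLaw (L : FunctorLifting M H) (A : ∀ X : C, FreeAlgebra H X) (X : C) :
    (freeMonad A).obj (M.obj X) ⟶ M.obj ((freeMonad A).obj X) :=
  ((A (M.obj X)).desc ⟨M.obj (A X).alg.a, L.law (A X).alg.a ≫ M.map (A X).alg.str⟩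
    (M.map (A X).unit)).f

/-- The image under `J` of a free `H`-algebra is a free algebra for the lifting of `H`. -/
abbrev liftFreeAlgebra (L : FunctorLifting M H) (A : ∀ X : C, FreeAlgebra H X) (X : Kleisli M) :
    FreeAlgebra L.functor X where
  alg := ⟨.mk M (A X.of).alg.a, (J M).map (A X.of).alg.str⟩
  unit := (J M).map (A X.of).unit
  desc B f :=
    { f := .mk ((A X.of).desc ⟨M.obj B.a.of, L.law B.a.of ≫ M.map B.str.of ≫ M.μ.app B.a.of⟩
        f.of).f
      h := (L.isAlgebraHom_iff _ _ _).2 (Algebra.Hom.h _) }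
  unit_desc B f := by
    apply Kleisli.hom_ext
    exact (J_map_comp_of _ _).trans ((A X.of).unit_desc _ _)
  hom_ext {B} g h w := by
    have w' : (A X.of).unit ≫ g.f.of = (A X.of).unit ≫ h.f.of :=
      (J_map_comp_of _ _).symm.trans ((congrArg Kleisli.Hom.of w).trans (J_map_comp_of _ _))
    have key := (A X.of).hom_ext
      (B := ⟨M.obj B.a.of, L.law B.a.of ≫ M.map B.str.of ≫ M.μ.app B.a.of⟩)
      ⟨g.f.of, (L.isAlgebraHom_iff _ _ _).1 g.h⟩ ⟨h.f.of, (L.isAlgebraHom_iff _ _ _).1 h.h⟩ w'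
    apply Algebra.ext
    apply Kleisli.hom_ext
    exact congrArg Algebra.Hom.f key

end Lifting

end KleisliTrace

namespace KleisliTrace

/-! ### Bounded set functors -/

/-- A set functor is bounded if all elements of its values come from a small family of sets. -/
def IsBounded (G : Type u ⥤ Type u) : Prop :=
  ∃ (I : Type u) (K : I → Type u), ∀ (Y : Type u) (y : G.obj Y),
    ∃ (i : I) (h : G.obj (K i)) (f : K i ⟶ Y), G.map f h = y

theorem map_map_apply (G : Type u ⥤ Type u) {X Y Z : Type u} (f : X ⟶ Y) (g : Y ⟶ Z)
    (y : G.obj X) : G.map g (G.map f y) = G.map (f ≫ g) y := by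
  rw [G.map_comp]; rfl

theorem map_apply_congr (G : Type u ⥤ Type u) {X Y : Type u} {f g : X ⟶ Y}
    (h : ∀ x, f x = g x) (y : G.obj X) : G.map f y = G.map g y := by
  obtain rfl : f = g := by ext x; exact h x
  rfl

theorem isBounded_of_isAccessible (G : Type u ⥤ Type u) [Functor.IsAccessible.{u} G] :
    IsBounded G := by
  obtain ⟨κ, hκ, hG⟩ := Functor.IsAccessible.exists_cardinal.{u} (F := G)
  refine ⟨Set κ.out, fun S => S, fun Y y => ?_⟩
  have := G.preservesColimitsOfShape_of_isCardinalAccessible κ (HasCardinalLT.Set Y κ)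
  obtain ⟨⟨S, hS⟩, h, rfl⟩ := Types.jointly_surjective_of_isColimit
    (isColimitOfPreserves G (HasCardinalLT.Set.isColimitCocone Y κ hκ.out.aleph0_le)) y
  rw [hasCardinalLT_iff_cardinal_mk_lt, ← Cardinal.mk_out κ] at hS
  obtain ⟨e⟩ := Cardinal.le_def _ _ |>.1 hS.le
  let e' := Equiv.ofInjective e e.injective
  refine ⟨Set.range e, G.map (↾e') h, ↾(fun x => ((e'.symm x : S) : Y)), ?_⟩
  refine (map_map_apply G _ _ _).trans (map_apply_congr G (fun x => ?_) h)
  exact congrArg Subtype.val (e'.symm_apply_apply x)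

/-- Well-founded trees with leaves labelled in `X` and nodes of shape `s` with arity `P s`. -/
inductive Tree (S : Type u) (P : S → Type u) (X : Type u) : Type u
  | leaf (x : X) : Tree S P X
  | node (s : S) (t : P s → Tree S P X) : Tree S P X

namespace Tree

variable {G : Type u ⥤ Type u} {I : Type u} {K : I → Type u} {X : Type u}

/-- The value of a tree in a `G`-algebra, for a valuation of its leaves. -/
def eval (B : Algebra G) (f : X ⟶ B.a) :
    Tree (Σ i, G.obj (K i)) (fun s => K s.1) X → B.a
  | leaf x => f x
  | node s t => B.str (G.map (↾fun p => eval B f (t p)) s.2)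

/-- Two trees are equivalent if they have the same value in all algebras. -/
def evalSetoid (G : Type u ⥤ Type u) (K : I → Type u) (X : Type u) :
    Setoid (Tree (Σ i, G.obj (K i)) (fun s => K s.1) X) where
  r t t' := ∀ (B : Algebra G) (f : X ⟶ B.a), eval B f t = eval B f t'
  iseqv := ⟨fun _ _ _ => rfl, fun h B f => (h B f).symm, fun h h' B f => (h B f).trans (h' B f)⟩

/-- The value of a class of trees in an algebra. -/
def evalQuot (B : Algebra G) (f : X ⟶ B.a) : Quotient (evalSetoid G K X) ⟶ B.a :=
  ↾Quotient.lift (eval B f) (fun _ _ h => h B f)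

theorem exists_str (hK : ∀ (Y : Type u) (y : G.obj Y),
      ∃ (i : I) (h : G.obj (K i)) (f : K i ⟶ Y), G.map f h = y)
    (y : G.obj (Quotient (evalSetoid G K X))) :
    ∃ z : Quotient (evalSetoid G K X), ∀ (B : Algebra G) (f : X ⟶ B.a),
      evalQuot B f z = B.str (G.map (evalQuot B f) y) := by
  obtain ⟨i, h, g, rfl⟩ := hK _ y
  refine ⟨⟦node ⟨i, h⟩ fun p => (g p).out⟧, fun B f => ?_⟩
  rw [map_map_apply]
  refine congrArg B.str (map_apply_congr G (fun p => ?_) h)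
  change evalQuot B f ⟦(g p).out⟧ = _
  rw [Quotient.out_eq]
  rfl

end Tree

theorem IsBounded.nonempty_freeAlgebra {G : Type u ⥤ Type u} (hG : IsBounded G) (X : Type u) :
    Nonempty (FreeAlgebra G X) := by
  obtain ⟨I, K, hK⟩ := hG
  choose str hstr using Tree.exists_str (X := X) hK
  let Q : Algebra G := ⟨Quotient (Tree.evalSetoid G K X), ↾str⟩
  let ι : X ⟶ Q.a := ↾fun x => ⟦Tree.leaf x⟧
  let d (B : Algebra G) (f : X ⟶ B.a) : Q ⟶ B :=
    { f := Tree.evalQuot B f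
      h := by ext y; exact (hstr y B f).symm }
  have eval_hom {B : Algebra G} (g : Q ⟶ B)
      (t : Tree (Σ i, G.obj (K i)) (fun s => K s.1) X) :
      g.f (Tree.evalQuot Q ι ⟦t⟧) = Tree.eval B (ι ≫ g.f) t := by
    induction t with
    | leaf x => rfl
    | node s t ih =>
      change g.f (Q.str (G.map _ _)) = B.str (G.map _ _)
      have h := ConcreteCategory.congr_hom g.h
        (G.map (↾fun p => Tree.eval Q ι (t p)) s.2)
      refine h.symm.trans ?_
      change B.str (G.map g.f (G.map _ _)) = _
      rw [map_map_apply]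
      exact congrArg B.str (map_apply_congr G ih s.2)
  have eval_id (z : Q.a) : Tree.evalQuot Q ι z = z := by
    induction z using Quotient.inductionOn with
    | h t =>
      refine Quotient.inductionOn (Tree.evalQuot Q ι ⟦t⟧) (motive := fun z => _ = z → z = ⟦t⟧)
        (fun t' h => Quotient.sound fun B f => ?_) rfl
      have h1 := eval_hom (d B f) t
      rw [h] at h1
      exact h1
  exact ⟨{
    alg := Q
    unit := ι
    desc := d
    unit_desc B f := rfl
    hom_ext {B} g h w := by
      ext z
      induction z using Quotient.inductionOn with
      | h t =>
        have hg := eval_hom g t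
        rw [w, ← eval_hom h t, eval_id] at hg
        exact hg }⟩

theorem IsBounded.hasInitial_algebra {G : Type u ⥤ Type u} (hG : IsBounded G) :
    HasInitial (Algebra G) := by
  obtain ⟨A⟩ := hG.nonempty_freeAlgebra PEmpty
  have (B : Algebra G) : Unique (A.alg ⟶ B) :=
    { default := A.desc B (↾PEmpty.elim)
      uniq g := A.hom_ext _ _ (by ext x; exact x.elim) }
  exact hasInitial_of_unique A.alg

theorem IsBounded.of_surjective {F G : Type u ⥤ Type u} (hF : IsBounded F) (q : F ⟶ G)
    (hq : ∀ X, Function.Surjective (q.app X)) : IsBounded G := by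
  obtain ⟨I, K, hK⟩ := hF
  refine ⟨I, K, fun Y y => ?_⟩
  obtain ⟨y, rfl⟩ := hq Y y
  obtain ⟨i, h, f, rfl⟩ := hK Y y
  exact ⟨i, q.app _ h, f, (ConcreteCategory.congr_hom (q.naturality f) h).symm⟩

theorem IsBounded.comp {F G : Type u ⥤ Type u} (hF : IsBounded F) (hG : IsBounded G) :
    IsBounded (F ⋙ G) := by
  obtain ⟨I, K, hK⟩ := hF
  obtain ⟨I', K', hK'⟩ := hG
  refine ⟨Σ i : I', (K' i → I), fun s => Σ k : K' s.1, K (s.2 k), fun Y y => ?_⟩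
  obtain ⟨i, h, f, rfl⟩ := hK' _ y
  choose j w g hg using fun k => hK Y (f k)
  refine ⟨⟨i, j⟩, G.map (↾fun k => F.map (↾Sigma.mk k) (w k)) h, ↾fun x => g x.1 x.2, ?_⟩
  refine (map_map_apply G _ _ _).trans (map_apply_congr G (fun k => ?_) h)
  refine Eq.trans ?_ (hg k)
  exact map_map_apply F _ _ _

theorem coprod_eq_inl_or_inr {X Y : Type u} (z : (X ⨿ Y : Type u)) :
    (∃ x : X, (coprod.inl : X ⟶ X ⨿ Y) x = z) ∨ (∃ y : Y, (coprod.inr : Y ⟶ X ⨿ Y) y = z) := by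
  obtain ⟨⟨_ | _⟩, x, rfl⟩ := Types.jointly_surjective' z
  · exact Or.inl ⟨x, rfl⟩
  · exact Or.inr ⟨x, rfl⟩

theorem isBounded_coprod_left (X : Type u) :
    IsBounded (coprod.functor.obj X : Type u ⥤ Type u) := by
  refine ⟨ULift Bool, fun b => ULift (PLift (b.down = true)), fun Y y => ?_⟩
  obtain ⟨x, rfl⟩ | ⟨y, rfl⟩ := coprod_eq_inl_or_inr y
  · let f : ULift (PLift (false = true)) ⟶ Y := ↾fun p => nomatch p.down.down
    exact ⟨⟨false⟩, (coprod.inl : X ⟶ X ⨿ _) x, f,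
      ConcreteCategory.congr_hom (coprod.inl_map (𝟙 X) f) x⟩
  · let f : ULift (PLift (true = true)) ⟶ Y := ↾fun _ => y
    exact ⟨⟨true⟩, (coprod.inr : _ ⟶ X ⨿ _) ⟨⟨rfl⟩⟩, f,
      ConcreteCategory.congr_hom (coprod.inr_map (𝟙 X) f) ⟨⟨rfl⟩⟩⟩

theorem isBounded_coprod_right (Y : Type u) :
    IsBounded (coprod.functor.flip.obj Y : Type u ⥤ Type u) :=
  (isBounded_coprod_left Y).of_surjective
    { app := fun X => (coprod.braiding Y X).hom
      naturality := fun X X' f => by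
        change coprod.map (𝟙 Y) f ≫ _ = _ ≫ coprod.map f (𝟙 Y)
        ext <;> simp }
    (fun X => (epi_iff_surjective (coprod.braiding Y X).hom).1 inferInstance)

theorem FreeAlgebra.induction {H : Type u ⥤ Type u} {X : Type u} (A : FreeAlgebra H X)
    {P : A.alg.a → Prop} (unit : ∀ x, P (A.unit x))
    (str : ∀ y : H.obj (Subtype P), P (A.alg.str (H.map (↾Subtype.val) y))) (z : A.alg.a) :
    P z := by
  let B : Algebra H := ⟨Subtype P, ↾fun y => ⟨_, str y⟩⟩
  let g : A.alg ⟶ B := A.desc B (↾fun x => ⟨_, unit x⟩)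
  let j : B ⟶ A.alg := { f := ↾Subtype.val, h := rfl }
  have h : g ≫ j = 𝟙 _ := by
    apply A.hom_ext
    rw [Algebra.comp_f, A.unit_desc_assoc]
    rfl
  have hj : g.f ≫ j.f = 𝟙 _ := congrArg Algebra.Hom.f h
  have hz := ConcreteCategory.congr_hom hj z
  change (g.f z).1 = z at hz
  exact hz ▸ (g.f z).2

/-- The positions of the leaves of a tree. -/
def Tree.Pos {S : Type u} {P : S → Type u} {X : Type u} : Tree S P X → Type u
  | leaf _ => PUnit
  | node _ t => Σ p, Pos (t p)

theorem IsBounded.freeMonad {H : Type u ⥤ Type u} (hH : IsBounded H)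
    (A : ∀ X : Type u, FreeAlgebra H X) : IsBounded (freeMonad A).toFunctor := by
  obtain ⟨I, K, hK⟩ := hH
  refine ⟨Tree I K PUnit, Tree.Pos, fun Y y => ?_⟩
  refine FreeAlgebra.induction (A Y) (P := fun y => ∃ (i : Tree I K PUnit)
    (h : (KleisliTrace.freeMonad A).obj i.Pos) (f : i.Pos ⟶ Y),
    (KleisliTrace.freeMonad A).map f h = y) (fun y => ?_) (fun y => ?_) y
  · let f : (Tree.leaf ⟨⟩ : Tree I K PUnit).Pos ⟶ Y := ↾fun _ => y
    exact ⟨_, (A (Tree.leaf ⟨⟩ : Tree I K PUnit).Pos).unit PUnit.unit, f,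
      ConcreteCategory.congr_hom ((A _).unit_desc (A Y).alg (f ≫ (A Y).unit)) PUnit.unit⟩
  · obtain ⟨i, h, g, rfl⟩ := hK _ y
    choose t w f hf using fun k => (g k).2
    let f' : (Tree.node i t).Pos ⟶ Y := ↾fun p => f p.1 p.2
    let s (k : K i) : (t k).Pos ⟶ (Tree.node i t).Pos := ↾fun p => ⟨k, p⟩
    refine ⟨_, (A _).alg.str (H.map (↾fun k => (KleisliTrace.freeMonad A).map (s k) (w k)) h),
      f', ?_⟩
    refine (ConcreteCategory.congr_hom
      ((A _).desc (A Y).alg (f' ≫ (A Y).unit)).h _).symm.trans ?_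
    refine congrArg (A Y).alg.str ?_
    refine (map_map_apply H _ _ _).trans (Eq.trans ?_ (map_map_apply H _ _ _).symm)
    refine map_apply_congr H (fun k => ?_) h
    refine Eq.trans ?_ (hf k)
    exact map_map_apply (KleisliTrace.freeMonad A).toFunctor _ _ _

/-! ### Initial algebras along left adjoints -/

section LeftAdjoint

universe v₁ v₂ u₁ u₂

variable {C : Type u₁} [Category.{v₁} C] {D : Type u₂} [Category.{v₂} D]

theorem hasInitial_algebra_of_leftAdjoint {L : C ⥤ D} {U : D ⥤ C} (adj : L ⊣ U)
    {G : C ⥤ C} {F : D ⥤ D} (e : L ⋙ F ≅ G ⋙ L) [HasInitial (Algebra G)] :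
    HasInitial (Algebra F) := by
  let I := ⊥_ (Algebra G)
  let T (B : Algebra F) : Algebra G :=
    ⟨U.obj B.a, adj.homEquiv _ _ (e.inv.app _ ≫ F.map (adj.counit.app B.a) ≫ B.str)⟩
  let LI : Algebra F := ⟨L.obj I.a, e.hom.app I.a ≫ L.map I.str⟩
  have key (B : Algebra F) (f : I.a ⟶ U.obj B.a) :
      F.map ((adj.homEquiv _ _).symm f) ≫ B.str = LI.str ≫ (adj.homEquiv _ _).symm f ↔
        G.map f ≫ (T B).str = I.str ≫ f := by
    have h1 : F.map ((adj.homEquiv _ _).symm f) ≫ B.str =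
        e.hom.app I.a ≫ (adj.homEquiv _ _).symm (G.map f ≫ (T B).str) := by
      have := e.hom.naturality f
      dsimp at this
      rw [adj.homEquiv_naturality_left_symm, Equiv.symm_apply_apply, ← reassoc_of% this,
        Iso.hom_inv_id_app_assoc, adj.homEquiv_counit, F.map_comp, Category.assoc]
    have h2 : LI.str ≫ (adj.homEquiv _ _).symm f =
        e.hom.app I.a ≫ (adj.homEquiv _ _).symm (I.str ≫ f) := by
      rw [adj.homEquiv_naturality_left_symm, Category.assoc]
    rw [h1, h2, cancel_epi, (adj.homEquiv _ _).symm.injective.eq_iff]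
  have (B : Algebra F) : Unique (LI ⟶ B) :=
    { default := ⟨_, (key B (initial.to (T B)).f).2 (initial.to (T B)).h⟩
      uniq g := by
        apply Algebra.ext
        obtain ⟨f, hf⟩ := (adj.homEquiv I.a B.a).symm.surjective g.f
        have hg := g.h
        rw [← hf] at hg
        have := congrArg Algebra.Hom.f
          (initial.hom_ext (⟨f, (key B f).1 hg⟩ : I ⟶ T B) (initial.to (T B)))
        exact hf.symm.trans (congrArg (adj.homEquiv I.a B.a).symm this) }
  exact hasInitial_of_unique LI

/-- A functor that preserves binary coproducts commutes with `Id + Y`. -/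
noncomputable def coprodFlipIso [HasBinaryCoproducts C] [HasBinaryCoproducts D] (L : C ⥤ D)
    [PreservesColimitsOfShape (Discrete WalkingPair) L] (Y : C) :
    L ⋙ coprod.functor.flip.obj (L.obj Y) ≅ coprod.functor.flip.obj Y ⋙ L :=
  NatIso.ofComponents (fun X => PreservesColimitPair.iso L X Y) (fun {X X'} f => by
    have h := coprodComparison_natural L f (𝟙 Y)
    rw [L.map_id] at h
    exact h.symm)

end LeftAdjoint

variable {C : Type u} [Category.{v} C] (M : Monad C)

theorem Kleisli.hasCoproducts [HasCoproducts.{v} C] : HasCoproducts.{v} (Kleisli M) := by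
  intro ι
  have (F : Discrete ι ⥤ Kleisli M) : HasColimit F := by
    have : (J M).IsLeftAdjoint := (Kleisli.Adjunction.adj M).isLeftAdjoint
    let F' : Discrete ι ⥤ C := Discrete.functor fun i => (F.obj ⟨i⟩).of
    let e : F' ⋙ J M ≅ F := Discrete.natIso fun i => Iso.refl _
    exact hasColimit_of_iso e.symm
  exact ⟨this⟩

variable {M}

theorem hasParametrizedInitialAlgebras_of_iso [HasBinaryCoproducts C]
    [HasBinaryCoproducts (Kleisli M)] {G : C ⥤ C} {F : Kleisli M ⥤ Kleisli M}
    (e : J M ⋙ F ≅ G ⋙ J M) (hG : HasParametrizedInitialAlgebras G) :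
    HasParametrizedInitialAlgebras F := by
  intro Y
  have : (J M).IsLeftAdjoint := (Kleisli.Adjunction.adj M).isLeftAdjoint
  have := hG Y.of
  let e' : (J M ⋙ coprod.functor.flip.obj Y) ⋙ F ≅ (coprod.functor.flip.obj Y.of ⋙ J M) ⋙ F :=
    Functor.isoWhiskerRight (coprodFlipIso (J M) Y.of) F
  exact hasInitial_algebra_of_leftAdjoint (Kleisli.Adjunction.adj M)
    ((Functor.associator _ _ _).symm ≪≫ e' ≪≫ Functor.associator _ _ _ ≪≫
      Functor.isoWhiskerLeft (coprod.functor.flip.obj Y.of) e ≪≫ (Functor.associator _ _ _).symm)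

/-! ### Liftings and distributive laws -/

section Lifting

variable {C : Type u} [Category.{v} C]

theorem FreeAlgebra.desc_eq {F : C ⥤ C} {X : C} (A : FreeAlgebra F X) {B : Algebra F}
    {f : X ⟶ B.a} {g : A.alg.a ⟶ B.a} (hom : F.map g ≫ B.str = A.alg.str ≫ g)
    (unit : A.unit ≫ g = f) : (A.desc B f).f = g :=
  congrArg Algebra.Hom.f (A.hom_ext (A.desc B f) ⟨g, hom⟩ ((A.unit_desc B f).trans unit.symm))

theorem monad_ext {S T : Monad C} (h : S.toFunctor = T.toFunctor)
    (hη : ∀ X, S.η.app X ≫ eqToHom (Functor.congr_obj h X) = T.η.app X)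
    (hμ : ∀ X, S.μ.app X ≫ eqToHom (Functor.congr_obj h X) =
      eqToHom (by rw [Functor.comp_obj, Functor.comp_obj, h]) ≫ T.μ.app X) : S = T := by
  obtain ⟨F, η, μ⟩ := S
  obtain ⟨G, η', μ'⟩ := T
  dsimp only at h
  subst h
  obtain rfl : η = η' := by ext X; simpa using hη X
  obtain rfl : μ = μ' := by ext X; simpa using hμ X
  rfl

variable {M : Monad C}

theorem FunctorLifting.map_comp_map {H : C ⥤ C} (L : FunctorLifting M H) {X Y Z : C}
    (f : X ⟶ M.obj Y) (g : Y ⟶ Z) : L.map (f ≫ M.map g) = L.map f ≫ M.map (H.map g) := by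
  have h := L.map_kleisliComp f (g ≫ M.η.app Z)
  rw [L.map_J] at h
  simpa using h

theorem FunctorLifting.map_comp {H : C ⥤ C} (L : FunctorLifting M H) {X Y Z : C}
    (f : X ⟶ Y) (g : Y ⟶ M.obj Z) : L.map (f ≫ g) = H.map f ≫ L.map g := by
  rw [L.map_eq_law, L.map_eq_law g, H.map_comp, Category.assoc]

theorem MonadLifting.isDistributiveLaw {T : Monad C} (L : MonadLifting M T) :
    IsDistributiveLaw T M L.law where
  naturality f := by
    change T.map (M.map f) ≫ L.map (𝟙 _) = L.map (𝟙 _) ≫ M.map (T.map f)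
    rw [← L.map_comp, ← L.map_comp_map, Category.comp_id, Category.id_comp]
  unit_right X := by
    have h := L.map_J (𝟙 X)
    rw [Category.id_comp, T.map_id, Category.id_comp] at h
    rw [FunctorLifting.law, ← L.map_comp, Category.comp_id, h]
  mul_right X := by
    have h := L.map_kleisliComp (𝟙 (M.obj (M.obj X))) (𝟙 (M.obj X))
    rw [M.map_id, Category.id_comp, Category.id_comp] at h
    rw [FunctorLifting.law, ← L.map_comp, Category.comp_id]
    exact h
  unit_left X := (L.unit_naturality (𝟙 _)).symm.trans (Category.id_comp _)
  mul_left X := by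
    have h := L.mul_naturality (𝟙 (M.obj X))
    rw [L.map_eq_law (L.map _), Category.assoc] at h
    exact h.symm

section Free

variable {H : C ⥤ C} (L : FunctorLifting M H) (A : ∀ X : C, FreeAlgebra H X)

theorem freeLaw_isHom (X : C) :
    H.map (freeLaw L A X) ≫ L.law (A X).alg.a ≫ M.map (A X).alg.str =
      (A (M.obj X)).alg.str ≫ freeLaw L A X :=
  ((A (M.obj X)).desc _ _).h

theorem unit_freeLaw (X : C) : (A (M.obj X)).unit ≫ freeLaw L A X = M.map (A X).unit :=
  (A (M.obj X)).unit_desc _ _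

theorem freeMonad_liftFreeAlgebra_map_of {X Y : Kleisli M} (f : X ⟶ Y) :
    ((freeMonad (liftFreeAlgebra L A)).map f).of =
      (freeMonad A).map f.of ≫ freeLaw L A Y.of := by
  refine (A X.of).desc_eq ?_ ?_
  · have h := ((A X.of).desc (A (M.obj Y.of)).alg (f.of ≫ (A _).unit)).h
    have h' : M.map ((A Y.of).alg.str ≫ M.η.app _) ≫ M.μ.app _ = M.map (A Y.of).alg.str := by
      simp
    change H.map (_ ≫ _) ≫ L.law _ ≫ M.map (_ ≫ M.η.app _) ≫ M.μ.app _ = _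
    dsimp at h ⊢
    rw [h', H.map_comp, Category.assoc, freeLaw_isHom, reassoc_of% h]
  · refine Eq.trans ?_ (comp_J_map_of f _).symm
    simp [unit_freeLaw]

theorem freeMonad_liftFreeAlgebra_μ (X : Kleisli M) :
    (freeMonad (liftFreeAlgebra L A)).μ.app X = (J M).map ((freeMonad A).μ.app X.of) := by
  refine (liftFreeAlgebra L A _).desc_eq ?_ ?_
  · have h := ((A (A X.of).alg.a).desc (A X.of).alg (𝟙 _)).h
    exact (congrArg (· ≫ _) (L.functor_map_J _)).trans
      (((J M).map_comp _ _).symm.trans ((congrArg (J M).map h).trans ((J M).map_comp _ _)))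
  · refine ((J M).map_comp _ _).symm.trans ?_
    refine (congrArg (J M).map ((A (A X.of).alg.a).unit_desc _ _)).trans ?_
    exact (J M).map_id _

theorem map_η_freeLaw (X : C) :
    (freeMonad A).map (M.η.app X) ≫ freeLaw L A X = M.η.app ((freeMonad A).obj X) := by
  let B : Algebra H := ⟨M.obj (A X).alg.a, L.law (A X).alg.a ≫ M.map (A X).alg.str⟩
  have h := ((A X).desc (A (M.obj X)).alg (M.η.app X ≫ (A _).unit)).h
  have e1 := (A X).desc_eq (B := B) (f := (A X).unit ≫ M.η.app _)
    (g := (freeMonad A).map (M.η.app X) ≫ freeLaw L A X)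
    (by
      dsimp [B] at h ⊢
      rw [H.map_comp, Category.assoc, freeLaw_isHom, reassoc_of% h])
    (by
      dsimp
      rw [FreeAlgebra.unit_desc_assoc, Category.assoc, unit_freeLaw]
      exact (M.η.naturality _).symm)
  have e2 := (A X).desc_eq (B := B) (f := (A X).unit ≫ M.η.app _) (g := M.η.app _)
    (by
      have h' := L.map_J (𝟙 (A X).alg.a)
      rw [Category.id_comp, H.map_id, Category.id_comp, L.map_eq_law] at h'
      dsimp [B]
      rw [reassoc_of% h']
      exact (M.η.naturality _).symm)
    rfl
  exact e1.symm.trans e2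

/-- The lifting of the free monad on `H` given by the distributive law `freeLaw`. -/
def freeMonadLifting : MonadLifting M (freeMonad A) where
  map {X Y} f := (freeMonad A).map f ≫ freeLaw L A Y
  map_kleisliComp {X Y Z} f g := by
    have h := congrArg Kleisli.Hom.of ((freeMonad (liftFreeAlgebra L A)).map_comp
      (.mk f : Kleisli.mk M X ⟶ .mk M Y) (.mk g : Kleisli.mk M Y ⟶ .mk M Z))
    refine ((freeMonad_liftFreeAlgebra_map_of L A _).symm.trans h).trans ?_
    rw [Kleisli.category_comp_of, freeMonad_liftFreeAlgebra_map_of,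
      freeMonad_liftFreeAlgebra_map_of]
  map_J f := by
    rw [(freeMonad A).map_comp, Category.assoc, map_η_freeLaw]
  unit_naturality {X Y} f := by
    have h := congrArg Kleisli.Hom.of ((freeMonad (liftFreeAlgebra L A)).η.naturality
      (.mk f : Kleisli.mk M X ⟶ .mk M Y))
    refine ((comp_J_map_of _ _).symm.trans h).trans ((J_map_comp_of _ _).trans ?_)
    rw [freeMonad_liftFreeAlgebra_map_of]
  mul_naturality {X Y} f := by
    have h := congrArg Kleisli.Hom.of ((freeMonad (liftFreeAlgebra L A)).μ.naturality
      (.mk f : Kleisli.mk M X ⟶ .mk M Y))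
    rw [freeMonad_liftFreeAlgebra_μ, freeMonad_liftFreeAlgebra_μ] at h
    have h' := ((comp_J_map_of _ _).symm.trans h).trans (J_map_comp_of _ _)
    rw [freeMonad_liftFreeAlgebra_map_of, Functor.comp_map, freeMonad_liftFreeAlgebra_map_of,
      freeMonad_liftFreeAlgebra_map_of] at h'
    exact h'

theorem freeMonadLifting_law (X : C) : (freeMonadLifting L A).law X = freeLaw L A X := by
  change (freeMonad A).map (𝟙 _) ≫ _ = _
  rw [(freeMonad A).map_id, Category.id_comp]

theorem isDistributiveLaw_freeLaw : IsDistributiveLaw (freeMonad A) M (freeLaw L A) := by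
  rw [← funext (freeMonadLifting_law L A)]
  exact (freeMonadLifting L A).isDistributiveLaw

theorem freeMonadLifting_map_eq {X Y : Kleisli M} (f : X ⟶ Y) :
    (freeMonadLifting L A).functor.map f = (freeMonad (liftFreeAlgebra L A)).map f :=
  Kleisli.hom_ext (freeMonad_liftFreeAlgebra_map_of L A f).symm

theorem freeMonadLifting_monad :
    (freeMonadLifting L A).monad = freeMonad (liftFreeAlgebra L A) := by
  refine monad_ext (Functor.hext (fun X => rfl)
    fun X Y f => heq_of_eq (freeMonadLifting_map_eq L A f)) (fun X => ?_) (fun X => ?_)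
  · exact Category.comp_id _
  · refine (Category.comp_id _).trans (Eq.trans ?_ (Category.id_comp _).symm)
    exact (freeMonad_liftFreeAlgebra_μ L A X).symm

end Free

end Lifting

/-! ### Liftings along monad quotients -/

section Quotient

variable {M T R : Monad (Type u)} (L : MonadLifting M T) (q : T ⟶ R)

/-- A lifting of a monad along a quotient. -/
def quotientLifting (hq : IsMonadQuotient q) (map : ∀ {X Y : Type u} (_ : X ⟶ M.obj Y),
      R.obj X ⟶ M.obj (R.obj Y))
    (hmap : ∀ {X Y : Type u} (f : X ⟶ M.obj Y),
      q.app X ≫ map f = L.map f ≫ M.map (q.app Y)) : MonadLifting M R where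
  map := map
  map_kleisliComp {X Y Z} f g := by
    have := hq X
    rw [← cancel_epi (q.app X), hmap, L.map_kleisliComp, reassoc_of% (hmap f)]
    simp only [Category.assoc]
    rw [← M.map_comp_assoc, hmap g, M.map_comp, Category.assoc]
    congr 2
    exact (M.μ.naturality _).symm
  map_J {X Y} f := by
    have := hq X
    rw [← cancel_epi (q.app X), hmap, L.map_J, ← q.naturality_assoc, Category.assoc]
    congr 1
    exact (M.η.naturality _).symm
  unit_naturality {X Y} f := by
    rw [← q.app_η, M.map_comp, ← Category.assoc, L.unit_naturality, Category.assoc, ← hmap,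
      ← q.app_η, Category.assoc]
  mul_naturality {X Y} f := by
    have := hq X
    have := hq (R.obj X)
    have := isSplitEpi_of_epi (q.app X)
    rw [← cancel_epi (q.app (R.obj X)), ← cancel_epi (T.map (q.app X)), reassoc_of% (hmap (map f)),
      ← Category.assoc, ← L.map_comp, hmap f, L.map_comp_map, Category.assoc,
      ← M.map_comp, ← M.map_comp, ← Category.assoc (T.map _), ← q.app_μ, M.map_comp,
      ← Category.assoc, L.mul_naturality, Category.assoc, ← hmap, ← Category.assoc, q.app_μ]
    simp only [Category.assoc]

end Quotient

/-! ### The lifted quotient -/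

section Main

variable {M : Monad (Type u)}

theorem hasParametrizedInitialAlgebras_lifting [HasBinaryCoproducts (Kleisli M)]
    {G : Type u ⥤ Type u} (hG : IsBounded G) (L : FunctorLifting M G) :
    HasParametrizedInitialAlgebras L.functor :=
  hasParametrizedInitialAlgebras_of_iso
    (NatIso.ofComponents (fun _ => Iso.refl _) fun f =>
      (Category.comp_id _).trans ((L.functor_map_J f).trans (Category.id_comp _).symm))
    fun Y => ((isBounded_coprod_right Y).comp hG).hasInitial_algebra

theorem hasParametrizedInitialAlgebras_coprodMonad [HasBinaryCoproducts (Kleisli M)]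
    (X : Type u) :
    HasParametrizedInitialAlgebras (coprodMonad ((J M).obj X)).toFunctor := by
  have : (J M).IsLeftAdjoint := (Kleisli.Adjunction.adj M).isLeftAdjoint
  exact hasParametrizedInitialAlgebras_of_iso (coprodComparisonNatIso (J M) X)
    fun Y => ((isBounded_coprod_right Y).comp (isBounded_coprod_left X)).hasInitial_algebra

variable {H : Type u ⥤ Type u} (L : FunctorLifting M H) (A : ∀ X : Type u, FreeAlgebra H X)

/-- The monad morphism between lifted monads induced by a quotient. -/
def liftQuotient {R : Monad (Type u)} (q : freeMonad A ⟶ R) (Rt : MonadLifting M R)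
    (h : ∀ {X Y : Type u} (f : X ⟶ M.obj Y),
      q.app X ≫ Rt.map f = (freeMonadLifting L A).map f ≫ M.map (q.app Y)) :
    freeMonad (liftFreeAlgebra L A) ⟶ Rt.monad where
  app X := (J M).map (q.app X.of)
  naturality X Y f := by
    rw [← freeMonadLifting_map_eq]
    apply Kleisli.hom_ext
    exact (comp_J_map_of _ _).trans ((h f.of).symm.trans (J_map_comp_of _ _).symm)
  app_η X := ((J M).map_comp _ _).symm.trans (congrArg (J M).map (q.app_η X.of))
  app_μ X := by
    have e : (freeMonad (liftFreeAlgebra L A)).map ((J M).map (q.app X.of)) =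
        (J M).map ((freeMonad A).map (q.app X.of)) :=
      (freeMonadLifting_map_eq L A _).symm.trans ((freeMonadLifting L A).functor_map_J _)
    have h := congrArg (J M).map (q.app_μ X.of)
    rw [Functor.map_comp, Functor.map_comp, Functor.map_comp] at h
    exact (congrArg (· ≫ (J M).map (q.app X.of)) (freeMonad_liftFreeAlgebra_μ L A X)).trans
      (h.trans (congrArg (fun t => (t ≫ _) ≫ _) e.symm))

end Main

end KleisliTrace

open KleisliTrace in
theorem mainTheorem6
    (M : Monad (Type u)) [CppoEnriched (Kleisli M)] (hM : LeftStrict (Kleisli M))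
    (H : Type u ⥤ Type u) [Functor.IsAccessible.{u} H]
    (Ht : FunctorLifting M H) (hHt : LocallyContinuous Ht.functor) :
    (∀ X : Type u, Nonempty (FreeAlgebra H X)) ∧
    ∀ A : ∀ X : Type u, FreeAlgebra H X,
      IsDistributiveLaw (freeMonad A) M (freeLaw Ht A) ∧
      (∃ L : MonadLifting M (freeMonad A),
        (∀ (X Y : Type u) (f : X ⟶ M.obj Y),
          L.map f = (freeMonad A).map f ≫ freeLaw Ht A Y) ∧
        L.monad = freeMonad (liftFreeAlgebra Ht A)) ∧
      ∀ (R : Monad (Type u)) (q : freeMonad A ⟶ R), IsMonadQuotient q →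
        (∀ X : Type u, ∃ law' : R.obj (M.obj X) ⟶ M.obj (R.obj X),
          freeLaw Ht A X ≫ M.map (q.app X) = q.app (M.obj X) ≫ law') →
        ∃ (Rt : MonadLifting M R) (qt : freeMonad (liftFreeAlgebra Ht A) ⟶ Rt.monad),
          (∀ X : Type u, qt.app ((J M).obj X) = (J M).map (q.app X)) ∧
          ∀ X : Type u,
            QuotientAssumption Ht.functor (liftFreeAlgebra Ht A) ((J M).obj X) Rt.monad qt := by
  have hH := isBounded_of_isAccessible H
  refine ⟨hH.nonempty_freeAlgebra, fun A => ⟨isDistributiveLaw_freeLaw Ht A,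
    ⟨freeMonadLifting Ht A, fun X Y f => rfl, freeMonadLifting_monad Ht A⟩, ?_⟩⟩
  intro R q hq hlaw
  choose law' hlaw' using hlaw
  have hmap {X Y : Type u} (f : X ⟶ M.obj Y) : q.app X ≫ R.map f ≫ law' Y =
      (freeMonadLifting Ht A).map f ≫ M.map (q.app Y) := by
    rw [← q.naturality_assoc, ← hlaw', ← Category.assoc]
    rfl
  let Rt : MonadLifting M R :=
    quotientLifting (freeMonadLifting Ht A) q hq (fun {_ Y} f => R.map f ≫ law' Y) hmap
  have hR : IsBounded R.toFunctor :=
    (hH.freeMonad A).of_surjective q.toNatTrans fun X => (epi_iff_surjective _).1 (hq X)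
  have hC : HasCoproducts.{u} (Kleisli M) := Kleisli.hasCoproducts M
  have hC' : HasFiniteCoproducts (Kleisli M) := hasFiniteCoproducts_of_hasCoproducts.{u} _
  refine ⟨Rt, liftQuotient Ht A q Rt hmap, fun X => rfl, fun X => ?_⟩
  exact {
    hasCoproducts := hC
    leftStrict := hM
    locallyContinuous := hHt
    initial_free := by
      rw [← freeMonadLifting_monad]
      exact hasParametrizedInitialAlgebras_lifting (hH.freeMonad A)
        (freeMonadLifting Ht A).toFunctorLifting
    initial_exception := hasParametrizedInitialAlgebras_coprodMonad (H.obj X)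
    isMonadQuotient := fun Y => by
      have : (J M).IsLeftAdjoint := (Kleisli.Adjunction.adj M).isLeftAdjoint
      have := hq Y.of
      exact inferInstanceAs (Epi ((J M).map (q.app Y.of)))
    initial_quotient := hasParametrizedInitialAlgebras_lifting hR Rt.toFunctorLifting }
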